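/- Let $l\ge 1$ and consider the linear time-invariant distributed system \[ \dot x(t)=Ax(t)+Bu(t),\qquad y_i(t)=C_ix(t)+D_iu(t)\quad(i=1,\dots,l),\qquad z(t)=Kx(t), \] with real matrices $A\in\mathbb R^{n\times n}$, $B\in\mathbb R^{n\times m}$, $C_i\in\mathbb R^{p_i\times n}$, $D_i\in\mathbb R^{p_i\times m}$, $K\in\mathbb R^{r\times n}$. Solutions (here and below) are tuples of locally integrable functions on $\mathbb R$ whose state component is locally absolutely continuous and which satisfy the equations almost everywhere; "$f(t)\to 0$ as $t\to\infty$" means $\lim_{t\to\infty}\operatorname{ess\,sup}_{s\ge t}\|f(s)\|=0$. Let $\mathcal G$ be a communication graph on the nodes $\{1,\dots,l\}$ with adjacency matrix $[\gamma_{ij}]$, where $\gamma_{ij}=1$ if node $j$ sends information to node $i$ and $\gamma_{ij}=0$ otherwise. Suppose that $\mathcal G$ is either directed, balanced (i.e. $\sum_j\gamma_{ij}=\sum_j\gamma_{ji}$ for all $i$) and strongly connected, or undirected and connected. Theorem. The following two statements are equivalent. (a) There exist $q\in\mathbb N\cup\{0\}$, a real number $\gamma>0$ and real matrices $N_i,M_i\in\mathbb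 R^{q\times q}$, $H_i\in\mathbb R^{q\times m}$, $L_i\in\mathbb R^{q\times p_i}$, $R_i\in\mathbb R^{r\times q}$ $(i=1,\dots,l)$ such that the system \[ \dot w_i(t)=N_iw_i(t)+H_iu(t)+L_iy_i(t)+\gamma M_i\sum_{j=1}^l\gamma_{ij}\bigl(w_j(t)-w_i(t)\bigr),\qquad z_i(t)=R_iw_i(t)\qquad(i=1,\dots,l) \] is a distributed partial state estimator that achieves omniscience asymptotically, i.e. for every solution $(x,u,(y_i)_i,z)$ of the distributed system and every solution $((w_i)_i,(u,(y_i)_i),(z_i)_i)$ of the estimator with the same $u$ and $y_1,\dots,y_l$, one has $z_i(t)-z(t)\to0$ as $t\to\infty$ for all $i\in\{1,\dots,l\}$. (b) The distributed system is jointly partially detectable with respect to $K$, i.e. with $\tilde y=(y_1^\top,\dots,y_l^\top)^\top$, $\tilde C=[C_1^\top\ \cdots\ C_l^\top]^\top$ and $\tilde D=[D_1^\top\ \cdots\ D_l^\top]^\top$, any two solutions $(x_1,u,\tilde y,z_1)$ and $(x_2,u,\tilde y,z_2)$ of \[ \dot x=Ax+Bu,\qquad \tilde y=\tilde Cx+\tilde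 Du,\qquad z=Kx \] with the same $u$ and the same $\tilde y$ satisfy $z_1(t)-z_2(t)\to0$ as $t\to\infty$. -/

import Mathlib

open MeasureTheory Filter Topology Set
open scoped Matrix ENNReal

/-- `z(t) → 0` as `t → ∞` in the essential sense: `lim_{t → ∞} ess-sup_{s ≥ t} ‖z(s)‖ = 0`. -/
def EssTendstoZero {E : Type*} [NormedAddCommGroup E] (z : ℝ → E) : Prop :=
  Tendsto (fun t : ℝ => essSup (fun s => ‖z s‖ₑ) (volume.restrict (Ici t))) atTop (𝓝 0)

/-- `x` is locally absolutely continuous on `ℝ` and `ẋ(t) = f(t)` for almost every `t`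
(a Carathéodory solution on `ℝ`). -/
def IsODESolution {E : Type*} [NormedAddCommGroup E] [NormedSpace ℝ E] (x f : ℝ → E) : Prop :=
  (∀ a b : ℝ, AbsolutelyContinuousOnInterval x a b) ∧ ∀ᵐ t : ℝ, HasDerivAt x (f t) t

/-- The coefficients of a linear time-invariant system
`ẋ = A x + B u`, `y = C x + D u`, `z = K x`, with outputs indexed by `ι`. -/
structure LTISystem (n m r : ℕ) (ι : Type) where
  A : Matrix (Fin n) (Fin n) ℝ
  B : Matrix (Fin n) (Fin m) ℝ
  C : Matrix ι (Fin n) ℝ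
  D : Matrix ι (Fin m) ℝ
  K : Matrix (Fin r) (Fin n) ℝ

namespace LTISystem

variable {n m r : ℕ} {ι : Type} [Fintype ι]

/-- `(x, u, y, z)` is a locally integrable solution of the system on `ℝ`. -/
structure IsSolution (S : LTISystem n m r ι) (x : ℝ → Fin n → ℝ) (u : ℝ → Fin m → ℝ)
    (y : ℝ → ι → ℝ) (z : ℝ → Fin r → ℝ) : Prop where
  locallyIntegrable_x : LocallyIntegrable x volume
  locallyIntegrable_u : LocallyIntegrable u volume
  locallyIntegrable_y : LocallyIntegrable y volume
  locallyIntegrable_z : LocallyIntegrable z volume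
  state : IsODESolution x (fun t => S.A *ᵥ x t + S.B *ᵥ u t)
  output : ∀ᵐ t : ℝ, y t = S.C *ᵥ x t + S.D *ᵥ u t
  functional : ∀ᵐ t : ℝ, z t = S.K *ᵥ x t

/-- Partial detectability of `(A, C)` with respect to `K`: any two solutions with the same input
and the same output have asymptotically equal functionals `z = K x`. -/
def PartiallyDetectable (S : LTISystem n m r ι) : Prop :=
  ∀ (x₁ x₂ : ℝ → Fin n → ℝ) (u : ℝ → Fin m → ℝ) (y : ℝ → ι → ℝ) (z₁ z₂ : ℝ → Fin r → ℝ),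
    S.IsSolution x₁ u y z₁ → S.IsSolution x₂ u y z₂ → EssTendstoZero (fun t => z₁ t - z₂ t)

end LTISystem

/-- The coefficients of a distributed linear time-invariant system with `l` nodes:
`ẋ = A x + B u`, `yᵢ = Cᵢ x + Dᵢ u` for `i = 1, …, l`, `z = K x`. -/
structure DistributedSystem (n m r l : ℕ) (p : Fin l → ℕ) where
  A : Matrix (Fin n) (Fin n) ℝ
  B : Matrix (Fin n) (Fin m) ℝ
  C : (i : Fin l) → Matrix (Fin (p i)) (Fin n) ℝ
  D : (i : Fin l) → Matrix (Fin (p i)) (Fin m) ℝ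
  K : Matrix (Fin r) (Fin n) ℝ

namespace DistributedSystem

variable {n m r l : ℕ} {p : Fin l → ℕ}

/-- The centralized system with the stacked output `ỹ = (y₁, …, yₗ)`: its output matrices `C̃`, `D̃`
are the `Cᵢ`, respectively the `Dᵢ`, written one below the other. -/
def stacked (S : DistributedSystem n m r l p) : LTISystem n m r ((i : Fin l) × Fin (p i)) where
  A := S.A
  B := S.B
  C := Matrix.of fun ik j => S.C ik.1 ik.2 j
  D := Matrix.of fun ik j => S.D ik.1 ik.2 j
  K := S.K

/-- Joint partial detectability with respect to `K`: `(A, C̃)` is partially detectable with respect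
to `K`. -/
def JointlyPartiallyDetectable (S : DistributedSystem n m r l p) : Prop :=
  S.stacked.PartiallyDetectable

/-- `(x, u, (yᵢ)ᵢ, z)` is a locally integrable solution of the distributed system on `ℝ`. -/
structure IsSolution (S : DistributedSystem n m r l p) (x : ℝ → Fin n → ℝ) (u : ℝ → Fin m → ℝ)
    (y : (i : Fin l) → ℝ → Fin (p i) → ℝ) (z : ℝ → Fin r → ℝ) : Prop where
  locallyIntegrable_x : LocallyIntegrable x volume
  locallyIntegrable_u : LocallyIntegrable u volume
  locallyIntegrable_y : ∀ i, LocallyIntegrable (y i) volume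
  locallyIntegrable_z : LocallyIntegrable z volume
  state : IsODESolution x (fun t => S.A *ᵥ x t + S.B *ᵥ u t)
  output : ∀ i, ∀ᵐ t : ℝ, y i t = S.C i *ᵥ x t + S.D i *ᵥ u t
  functional : ∀ᵐ t : ℝ, z t = S.K *ᵥ x t

end DistributedSystem

/-! A communication graph on the nodes `1, …, l` is a `Digraph (Fin l)`; the edge `G.Adj j i` means
that node `j` sends information to node `i`. -/

namespace CommGraph

variable {l : ℕ}

open Classical in
/-- The adjacency matrix `[γᵢⱼ]`: `γᵢⱼ = 1` if node `j` sends information to node `i`, and `0`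
otherwise. -/
noncomputable def adjacency (G : Digraph (Fin l)) : Matrix (Fin l) (Fin l) ℝ :=
  Matrix.of fun i j => if G.Adj j i then 1 else 0

/-- `∑ⱼ γᵢⱼ = ∑ⱼ γⱼᵢ` for every node `i`. -/
def Balanced (G : Digraph (Fin l)) : Prop :=
  ∀ i, ∑ j, adjacency G i j = ∑ j, adjacency G j i

/-- There is a directed path from every node to every other node. -/
def StronglyConnected (G : Digraph (Fin l)) : Prop :=
  ∀ i j, i ≠ j → Relation.TransGen G.Adj i j

/-- Every edge can be used in both directions (the adjacency matrix is symmetric). -/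
def Undirected (G : Digraph (Fin l)) : Prop :=
  ∀ i j, G.Adj i j → G.Adj j i

/-- There is an undirected path between every pair of distinct nodes. -/
def Connected (G : Digraph (Fin l)) : Prop :=
  ∀ i j, i ≠ j → Relation.TransGen (fun a b => G.Adj a b ∨ G.Adj b a) i j

end CommGraph

/-- The design parameters of a network of `l` local estimators, with local state spaces `ℝ^q`:
`ẇᵢ = Nᵢ wᵢ + Hᵢ u + Lᵢ yᵢ + γ Mᵢ ∑ⱼ γᵢⱼ (wⱼ - wᵢ)`, `zᵢ = Rᵢ wᵢ`, with `γ > 0`. The differences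
`wⱼ - wᵢ` presuppose a common dimension of the local states. -/
structure DistributedEstimator (q m r l : ℕ) (p : Fin l → ℕ) where
  N : Fin l → Matrix (Fin q) (Fin q) ℝ
  H : Fin l → Matrix (Fin q) (Fin m) ℝ
  L : (i : Fin l) → Matrix (Fin q) (Fin (p i)) ℝ
  M : Fin l → Matrix (Fin q) (Fin q) ℝ
  R : Fin l → Matrix (Fin r) (Fin q) ℝ
  γ : ℝ
  γ_pos : 0 < γ

namespace DistributedEstimator

variable {q n m r l : ℕ} {p : Fin l → ℕ}

/-- `((wᵢ)ᵢ, (u, (yᵢ)ᵢ), (zᵢ)ᵢ)` is a locally integrable solution on `ℝ` of the network of local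
estimators which communicate over the graph `G`. -/
structure IsSolution (O : DistributedEstimator q m r l p) (G : Digraph (Fin l))
    (w : Fin l → ℝ → Fin q → ℝ) (u : ℝ → Fin m → ℝ) (y : (i : Fin l) → ℝ → Fin (p i) → ℝ)
    (zhat : Fin l → ℝ → Fin r → ℝ) : Prop where
  locallyIntegrable_w : ∀ i, LocallyIntegrable (w i) volume
  locallyIntegrable_u : LocallyIntegrable u volume
  locallyIntegrable_y : ∀ i, LocallyIntegrable (y i) volume
  locallyIntegrable_zhat : ∀ i, LocallyIntegrable (zhat i) volume
  state : ∀ i, IsODESolution (w i) (fun t =>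
    O.N i *ᵥ w i t + O.H i *ᵥ u t + O.L i *ᵥ y i t
      + O.γ • (O.M i *ᵥ ∑ j, CommGraph.adjacency G i j • (w j t - w i t)))
  estimate : ∀ i, ∀ᵐ t : ℝ, zhat i t = O.R i *ᵥ w i t

/-- The network is a distributed partial state estimator for `S` that achieves omniscience
asymptotically: `zᵢ(t) - z(t) → 0` for every node `i`, every solution of `S`, and every solution of
the network which is driven by the same input and outputs. -/
def AchievesOmniscience (O : DistributedEstimator q m r l p) (G : Digraph (Fin l))
    (S : DistributedSystem n m r l p) : Prop :=
  ∀ (x : ℝ → Fin n → ℝ) (u : ℝ → Fin m → ℝ) (y : (i : Fin l) → ℝ → Fin (p i) → ℝ)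
    (z : ℝ → Fin r → ℝ) (w : Fin l → ℝ → Fin q → ℝ) (zhat : Fin l → ℝ → Fin r → ℝ),
    S.IsSolution x u y z → O.IsSolution G w u y zhat →
      ∀ i, EssTendstoZero (fun t => zhat i t - z t)

end DistributedEstimator

/-! Necessity: the difference of two solutions with the same input and outputs has zero input and
outputs, and for such data the network may stay at rest; omniscience then forces the functional of
the difference to zero.

Sufficiency: states on which all `Cᵢ Aᵏ` and `K Aᵏ` vanish are irrelevant and are factored out by a
matrix `T` (`exists_quotient`). On the quotient the stacked pair is detectable for the full state,
so every node can aim at all of `T x`. The errors `eᵢ = wᵢ - T x` follow the autonomous system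
`errorMap`, whose Lyapunov function is `∑ Rᵢ(eᵢ, eᵢ)` with `Rᵢ = g Pᵢ + Q`. The form `Pᵢ`
(`exists_observability_form`) handles what node `i` observes; `Q` (`exists_form_decreasing_on`)
decreases on the jointly unobservable subspace.

Taking `Mᵢ = Rᵢ⁻¹` makes the coupling Euclidean, so on a balanced graph it contributes `-γ` times
the disagreement. Finsler's lemma (`exists_pos_lt_mul_of_homogeneous`) is used twice: a large `g`
makes the derivative negative on consensus vectors, then a large `γ` makes it negative everywhere.
-/

/-! ### Linear differential equations, Finsler's lemma and Lyapunov equations. -/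

section LinearODE

variable {E : Type*} [NormedAddCommGroup E] [NormedSpace ℝ E]

/-- Every solution of `ẋ = F x` tends to zero. -/
def AsymptoticallyStable (F : E →ₗ[ℝ] E) : Prop :=
  ∀ x : ℝ → E, (∀ t, HasDerivAt x (F (x t)) t) → Tendsto x atTop (𝓝 0)

/-- The map `P ↦ Fᵀ P + P F` on bilinear forms. -/
def lyapunovMap (F : E →ₗ[ℝ] E) : LinearMap.BilinForm ℝ E →ₗ[ℝ] LinearMap.BilinForm ℝ E where
  toFun P := P.compl₁₂ F LinearMap.id + P.compl₁₂ LinearMap.id F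
  map_add' P Q := by ext; simp; ring
  map_smul' c P := by ext; simp

theorem lyapunovMap_apply (F : E →ₗ[ℝ] E) (P : LinearMap.BilinForm ℝ E) (x y : E) :
    lyapunovMap F P x y = P (F x) y + P x (F y) := by
  simp [lyapunovMap]

/-- Cauchy–Schwarz for a semidefinite form. -/
theorem LinearMap.BilinForm.eq_zero_of_self_eq_zero (P : LinearMap.BilinForm ℝ E)
    (hs : ∀ x y, P x y = P y x) (hP : ∀ x, 0 ≤ P x x) {v : E} (hv : P v v = 0) (w : E) :
    P v w = 0 := by
  have h := LinearMap.BilinForm.apply_mul_apply_le_of_forall_zero_le P hP v w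
  rw [hv, zero_mul, hs w v] at h
  exact mul_self_eq_zero.1 (le_antisymm h (mul_self_nonneg _))

variable [FiniteDimensional ℝ E]

theorem exists_hasDerivAt_linear (F : E →ₗ[ℝ] E) (v : E) :
    ∃ x : ℝ → E, x 0 = v ∧ ∀ t, HasDerivAt x (F (x t)) t := by
  have : CompleteSpace E := FiniteDimensional.complete ℝ E
  set F' : E →L[ℝ] E := LinearMap.toContinuousLinearMap F with hF
  refine ⟨fun t => NormedSpace.exp (t • F') v, by simp, fun t => ?_⟩
  have h := (hasDerivAt_exp_smul_const' (𝕂 := ℝ) F' t).clm_apply (hasDerivAt_const t v)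
  simpa [hF] using h

theorem HasDerivAt.bilinForm (P : LinearMap.BilinForm ℝ E) {x y : ℝ → E} {x' y' : E} {t : ℝ}
    (hx : HasDerivAt x x' t) (hy : HasDerivAt y y' t) :
    HasDerivAt (fun s => P (x s) (y s)) (P (x t) y' + P x' (y t)) t :=
  (LinearMap.toContinuousBilinearMap P).hasDerivAt_of_bilinear (fun _ => hx) (fun _ => hy)

theorem LinearMap.BilinForm.continuous_comp (P : LinearMap.BilinForm ℝ E)
    {X : Type*} [TopologicalSpace X] {x y : X → E} (hx : Continuous x) (hy : Continuous y) :
    Continuous fun s => P (x s) (y s) := by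
  have h : Continuous fun s => LinearMap.toContinuousBilinearMap P (x s) (y s) := by fun_prop
  exact h

/-- Finsler's lemma for continuous functions that are homogeneous of degree two. -/
theorem exists_pos_lt_mul_of_homogeneous {f h : E → ℝ} (hfc : Continuous f) (hhc : Continuous h)
    (hf : ∀ (c : ℝ) v, f (c • v) = c ^ 2 * f v) (hh : ∀ (c : ℝ) v, h (c • v) = c ^ 2 * h v)
    (hh0 : ∀ v, 0 ≤ h v) (hneg : ∀ v, v ≠ 0 → h v = 0 → f v < 0) :
    ∃ g : ℝ, 0 < g ∧ ∀ v, v ≠ 0 → f v < g * h v := by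
  have : ProperSpace E := FiniteDimensional.proper ℝ E
  -- Only unit vectors with `f ≥ 0` matter. They form a compact set on which `h` is positive, so its
  -- minimum `h a` is positive and `g = max f / min h + 1` works.
  have hK : IsCompact (Metric.sphere (0 : E) 1 ∩ {v | 0 ≤ f v}) :=
    (isCompact_sphere _ _).inter_right (isClosed_le continuous_const hfc)
  suffices H : ∃ g : ℝ, 0 < g ∧ ∀ v, ‖v‖ = 1 → f v < g * h v by
    obtain ⟨g, hg, H⟩ := H
    refine ⟨g, hg, fun v hv => ?_⟩
    have hn : 0 < ‖v‖ := norm_pos_iff.2 hv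
    have := H (‖v‖⁻¹ • v) (by rw [norm_smul, norm_inv, norm_norm, inv_mul_cancel₀ hn.ne'])
    rw [hf, hh, mul_left_comm] at this
    exact lt_of_mul_lt_mul_left this (by positivity)
  rcases (Metric.sphere (0 : E) 1 ∩ {v | 0 ≤ f v}).eq_empty_or_nonempty with he | hne
  · refine ⟨1, one_pos, fun v hv => ?_⟩
    have : f v < 0 := by
      by_contra hc
      have : v ∈ (∅ : Set E) := he ▸ ⟨by simpa using hv, not_lt.1 hc⟩
      exact absurd this (Set.notMem_empty v)
    linarith [hh0 v]
  · obtain ⟨a, ha, hamin⟩ := hK.exists_isMinOn hne hhc.continuousOn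
    obtain ⟨b, hb, hbmax⟩ := hK.exists_isMaxOn hne hfc.continuousOn
    have ha0 : a ≠ 0 := by
      rintro rfl
      simpa using ha.1
    have hpos : 0 < h a := by
      refine lt_of_le_of_ne (hh0 a) fun h0 => ?_
      exact absurd (hneg a ha0 h0.symm) (not_lt.2 ha.2)
    have hb0 : 0 ≤ f b := hb.2
    refine ⟨f b / h a + 1, by positivity, fun v hv => ?_⟩
    by_cases hfv : 0 ≤ f v
    · have hvK : v ∈ Metric.sphere (0 : E) 1 ∩ {v | 0 ≤ f v} := ⟨by simpa using hv, hfv⟩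
      have h1 : h a ≤ h v := hamin hvK
      have h2 : f v ≤ f b := hbmax hvK
      calc f v ≤ f b := h2
        _ < (f b / h a + 1) * h a := by field_simp; linarith
        _ ≤ _ := by gcongr
    · have : 0 ≤ (f b / h a + 1) * h v := mul_nonneg (by positivity) (hh0 v)
      linarith

/-- Finsler's lemma supplies both constants: `P ≤ g · (-Ṗ)` makes `exp(t/g) P(x, x)` nonincreasing,
and `‖x‖² ≤ k P(x, x)` turns this into exponential decay of `x`. -/
theorem asymptoticallyStable_of_lyapunov (F : E →ₗ[ℝ] E) (P : LinearMap.BilinForm ℝ E)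
    (hP : ∀ v, v ≠ 0 → 0 < P v v) (hF : ∀ v, v ≠ 0 → P v (F v) + P (F v) v < 0) :
    AsymptoticallyStable F := by
  intro x hx
  have hFc : Continuous F := F.continuous_of_finiteDimensional
  have hPc : Continuous fun v => P v v := P.continuous_comp continuous_id continuous_id
  have hDc : Continuous fun v => -(P v (F v) + P (F v) v) :=
    ((P.continuous_comp continuous_id hFc).add (P.continuous_comp hFc continuous_id)).neg
  have hPh (c : ℝ) (v : E) : P (c • v) (c • v) = c ^ 2 * P v v := by simp; ring
  have hP0 (v : E) : 0 ≤ P v v := by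
    rcases eq_or_ne v 0 with rfl | hv
    · simp
    · exact (hP v hv).le
  obtain ⟨g, hg, hgP⟩ := exists_pos_lt_mul_of_homogeneous (f := fun v => P v v)
    (h := fun v => -(P v (F v) + P (F v) v)) hPc hDc hPh (fun c v => by simp; ring)
    (fun v => by
      rcases eq_or_ne v 0 with rfl | hv
      · simp
      · linarith [hF v hv])
    (fun v hv h0 => absurd h0 (by linarith [hF v hv]))
  obtain ⟨k, hk, hkP⟩ := exists_pos_lt_mul_of_homogeneous (f := fun v : E => ‖v‖ ^ 2)
    (h := fun v => P v v) (by fun_prop) hPc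
    (fun c v => by rw [norm_smul, mul_pow, Real.norm_eq_abs, sq_abs]) hPh hP0
    (fun v hv h0 => absurd h0 (hP v hv).ne')
  have hanti : Antitone fun t => Real.exp (t / g) * P (x t) (x t) := by
    have hd (t : ℝ) : HasDerivAt (fun t => Real.exp (t / g) * P (x t) (x t))
        (Real.exp (t / g) * (1 / g) * P (x t) (x t)
          + Real.exp (t / g) * (P (x t) (F (x t)) + P (F (x t)) (x t))) t :=
      (((hasDerivAt_id t).div_const g).exp).mul ((hx t).bilinForm P (hx t))
    refine antitone_of_hasDerivAt_nonpos hd fun t => ?_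
    have h1 : P (x t) (x t) ≤ g * -(P (x t) (F (x t)) + P (F (x t)) (x t)) := by
      rcases eq_or_ne (x t) 0 with h | h
      · simp [h]
      · exact (hgP _ h).le
    have h2 : 1 / g * P (x t) (x t) ≤ -(P (x t) (F (x t)) + P (F (x t)) (x t)) := by
      rw [one_div, inv_mul_le_iff₀ hg]; exact h1
    have := mul_le_mul_of_nonneg_left h2 (Real.exp_pos (t / g)).le
    simp only [Pi.zero_apply]
    linarith
  have hbound : ∀ t : ℝ, 0 ≤ t → ‖x t‖ ^ 2 ≤ k * P (x 0) (x 0) * Real.exp (-(t / g)) := by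
    intro t ht
    have h1 := hanti ht
    simp only [zero_div, Real.exp_zero, one_mul] at h1
    have h2 : P (x t) (x t) ≤ P (x 0) (x 0) * Real.exp (-(t / g)) := by
      rw [Real.exp_neg, ← div_eq_mul_inv, le_div_iff₀ (Real.exp_pos _), mul_comm]; exact h1
    have h3 : ‖x t‖ ^ 2 ≤ k * P (x t) (x t) := by
      rcases eq_or_ne (x t) 0 with h | h
      · simp [h]
      · exact (hkP _ h).le
    rw [mul_assoc]
    exact h3.trans (mul_le_mul_of_nonneg_left h2 hk.le)
  have hlim : Tendsto (fun t : ℝ => k * P (x 0) (x 0) * Real.exp (-(t / g))) atTop (𝓝 0) := by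
    simpa using (Real.tendsto_exp_neg_atTop_nhds_zero.comp
      (tendsto_id.atTop_div_const hg)).const_mul (k * P (x 0) (x 0))
  have hsq : Tendsto (fun t => ‖x t‖ ^ 2) atTop (𝓝 0) :=
    tendsto_of_tendsto_of_tendsto_of_le_of_le' tendsto_const_nhds hlim
      (Eventually.of_forall fun t => by positivity)
      ((eventually_ge_atTop 0).mono hbound)
  rw [tendsto_zero_iff_norm_tendsto_zero]
  simpa [Real.sqrt_sq] using hsq.sqrt

/-- For `P` in the kernel, `P(x(t), y(t))` is constant along any two solutions, and its limit is
`P(0, 0) = 0`. -/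
theorem AsymptoticallyStable.lyapunovMap_injective {F : E →ₗ[ℝ] E} (hF : AsymptoticallyStable F) :
    Function.Injective (lyapunovMap F) := by
  rw [injective_iff_map_eq_zero]
  intro P hP
  ext v w
  obtain ⟨x, rfl, hx⟩ := exists_hasDerivAt_linear F v
  obtain ⟨y, rfl, hy⟩ := exists_hasDerivAt_linear F w
  have hd (t : ℝ) : HasDerivAt (fun s => P (x s) (y s)) 0 t := by
    have h := (hx t).bilinForm P (hy t)
    rwa [add_comm, ← lyapunovMap_apply, hP, LinearMap.zero_apply, LinearMap.zero_apply] at h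
  have hconst (t : ℝ) : P (x t) (y t) = P (x 0) (y 0) :=
    is_const_of_deriv_eq_zero (fun t => (hd t).differentiableAt) (fun t => (hd t).deriv) t 0
  have hlim : Tendsto (fun t => P (x t) (y t)) atTop (𝓝 (P 0 0)) := by
    have hc : Continuous fun q : E × E => P q.1 q.2 :=
      P.continuous_comp continuous_fst continuous_snd
    exact (hc.tendsto ((0 : E), (0 : E))).comp ((hF x hx).prodMk_nhds (hF y hy))
  simp only [hconst] at hlim
  simpa using tendsto_nhds_unique tendsto_const_nhds hlim

/-- A positive semidefinite Lyapunov equation of a stable linear map has a positive semidefinite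
solution. -/
theorem AsymptoticallyStable.exists_lyapunov {F : E →ₗ[ℝ] E} (hF : AsymptoticallyStable F)
    (W : LinearMap.BilinForm ℝ E) (hWs : ∀ x y, W x y = W y x) (hW : ∀ x, 0 ≤ W x x) :
    ∃ P : LinearMap.BilinForm ℝ E, (∀ x y, P x y = P y x) ∧ (∀ x, 0 ≤ P x x) ∧
      ∀ x y, P (F x) y + P x (F y) = -W x y := by
  -- Finite dimension turns uniqueness into existence. Symmetry follows from uniqueness, and `P ≥ 0`
  -- because `P(x, x)` decreases to `0` along solutions.
  obtain ⟨P, hP⟩ := (LinearMap.injective_iff_surjective.1 hF.lyapunovMap_injective) (-W)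
  have hPa (x y : E) : P (F x) y + P x (F y) = -W x y := by
    rw [← lyapunovMap_apply, hP]; simp
  have hsymm : P.flip = P := by
    refine hF.lyapunovMap_injective ?_
    ext x y
    rw [lyapunovMap_apply, lyapunovMap_apply, hPa, hWs, ← hPa]
    simp [add_comm]
  refine ⟨P, fun x y => ?_, fun v => ?_, hPa⟩
  · conv_lhs => rw [← hsymm]
    rfl
  obtain ⟨x, rfl, hx⟩ := exists_hasDerivAt_linear F v
  have hanti : Antitone fun s => P (x s) (x s) := by
    refine antitone_of_hasDerivAt_nonpos (fun t => (hx t).bilinForm P (hx t)) fun t => ?_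
    simp only [Pi.zero_apply]
    rw [add_comm, hPa]
    linarith [hW (x t)]
  have hlim : Tendsto (fun t => P (x t) (x t)) atTop (𝓝 (P 0 0)) := by
    have hc : Continuous fun q : E => P q q := P.continuous_comp continuous_id continuous_id
    exact (hc.tendsto 0).comp (hF x hx)
  simpa using hanti.le_of_tendsto hlim 0

end LinearODE

/-! ### Essential convergence to zero. -/

section EssTendstoZero

variable {E : Type*} [NormedAddCommGroup E]

theorem EssTendstoZero.congr_ae {x y : ℝ → E} (hx : EssTendstoZero x) (h : x =ᵐ[volume] y) :
    EssTendstoZero y := by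
  unfold EssTendstoZero at hx ⊢
  convert hx using 2 with t
  refine essSup_congr_ae (ae_restrict_of_ae ?_)
  filter_upwards [h] with s hs
  rw [hs]

theorem essTendstoZero_of_tendsto {x : ℝ → E} (hx : Tendsto x atTop (𝓝 0)) :
    EssTendstoZero x := by
  unfold EssTendstoZero
  rw [ENNReal.tendsto_nhds_zero]
  intro ε hε
  have h := (continuous_enorm.tendsto (0 : E)).comp hx
  rw [enorm_zero, ENNReal.tendsto_nhds_zero] at h
  obtain ⟨T, hT⟩ := eventually_atTop.1 (h ε hε)
  filter_upwards [eventually_ge_atTop T] with t ht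
  refine essSup_le_of_ae_le _ ?_
  filter_upwards [ae_restrict_mem measurableSet_Ici] with s hs
  exact hT s (ht.trans hs)

theorem Continuous.tendsto_zero_of_essTendstoZero {x : ℝ → E} (hc : Continuous x)
    (hx : EssTendstoZero x) : Tendsto x atTop (𝓝 0) := by
  rw [tendsto_zero_iff_enorm_tendsto_zero]
  -- The shift by `1` places the point in the interior of `Ici t`, where a violation would persist
  -- on an open set of positive measure.
  have hle (t : ℝ) (ht : 0 ≤ t) :
      ‖x (t + 1)‖ₑ ≤ essSup (fun s => ‖x s‖ₑ) (volume.restrict (Ici t)) := by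
    by_contra! hlt
    set c := essSup (fun s => ‖x s‖ₑ) (volume.restrict (Ici t)) with hcdef
    have ho : IsOpen (Ioi t ∩ {s | c < ‖x s‖ₑ}) :=
      isOpen_Ioi.inter (isOpen_lt continuous_const hc.enorm)
    have hpos := ho.measure_pos volume ⟨t + 1, by simp, hlt⟩
    have hae : ∀ᵐ s ∂(volume.restrict (Ici t)), ‖x s‖ₑ ≤ c := ae_le_essSup
    rw [ae_restrict_iff' measurableSet_Ici] at hae
    refine hpos.ne' (measure_mono_null ?_ hae)
    rintro s ⟨hs, hcs⟩ hcon
    exact absurd (hcon (Ioi_subset_Ici_self hs)) (not_le.2 hcs)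
  have h1 : Tendsto (fun t => ‖x (t + 1)‖ₑ) atTop (𝓝 0) :=
    tendsto_of_tendsto_of_tendsto_of_le_of_le' tendsto_const_nhds hx
      (Eventually.of_forall fun t => zero_le) ((eventually_ge_atTop 0).mono hle)
  have h2 := h1.comp (tendsto_atTop_add_const_right atTop (-1 : ℝ) tendsto_id)
  simpa [Function.comp_def] using h2

end EssTendstoZero

theorem AbsolutelyContinuousOnInterval.pi {E ι : Type*} [NormedAddCommGroup E] [Fintype ι]
    {x : ι → ℝ → E} {a b : ℝ}
    (hx : ∀ i, AbsolutelyContinuousOnInterval (x i) a b) :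
    AbsolutelyContinuousOnInterval (fun t i => x i t) a b := by
  unfold AbsolutelyContinuousOnInterval at hx ⊢
  refine squeeze_zero (fun I => Finset.sum_nonneg fun i _ => dist_nonneg) (fun I => ?_)
    (by simpa using tendsto_finsetSum Finset.univ fun i _ => hx i)
  rw [Finset.sum_comm]
  refine Finset.sum_le_sum fun k _ => ?_
  refine (dist_pi_le_iff (Finset.sum_nonneg fun i _ => dist_nonneg)).2 fun i => ?_
  exact Finset.single_le_sum (f := fun i => dist (x i (I.2 k).1) (x i (I.2 k).2))
    (fun i _ => dist_nonneg) (Finset.mem_univ i)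

/-! ### Carathéodory solutions. -/

section Caratheodory

variable {E F : Type*} [NormedAddCommGroup E] [NormedSpace ℝ E]
  [NormedAddCommGroup F] [NormedSpace ℝ F]

theorem AbsolutelyContinuousOnInterval.clm_apply {x : ℝ → E} {a b : ℝ}
    (hx : AbsolutelyContinuousOnInterval x a b) (L : E →L[ℝ] F) :
    AbsolutelyContinuousOnInterval (fun t => L (x t)) a b := by
  unfold AbsolutelyContinuousOnInterval at hx ⊢
  refine squeeze_zero (fun I => Finset.sum_nonneg fun i _ => dist_nonneg) (fun I => ?_)
    (by simpa using hx.const_mul ‖L‖)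
  rw [Finset.mul_sum]
  exact Finset.sum_le_sum fun i _ => L.dist_le_opNorm _ _

theorem IsODESolution.sub {x₁ x₂ f₁ f₂ : ℝ → E} (h₁ : IsODESolution x₁ f₁)
    (h₂ : IsODESolution x₂ f₂) :
    IsODESolution (fun t => x₁ t - x₂ t) (fun t => f₁ t - f₂ t) :=
  ⟨fun a b => (h₁.1 a b).sub (h₂.1 a b), by
    filter_upwards [h₁.2, h₂.2] with t ht₁ ht₂ using ht₁.sub ht₂⟩

theorem IsODESolution.clm_apply {x f : ℝ → E} (h : IsODESolution x f) (L : E →L[ℝ] F) :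
    IsODESolution (fun t => L (x t)) (fun t => L (f t)) :=
  ⟨fun a b => (h.1 a b).clm_apply L, by
    filter_upwards [h.2] with t ht using L.hasFDerivAt.comp_hasDerivAt t ht⟩

theorem IsODESolution.mulVec {ι κ : Type*} [Fintype ι] [Fintype κ] {x f : ℝ → ι → ℝ}
    (h : IsODESolution x f) (T : Matrix κ ι ℝ) :
    IsODESolution (fun t => T *ᵥ x t) (fun t => T *ᵥ f t) :=
  h.clm_apply (LinearMap.toContinuousLinearMap T.mulVecLin)

theorem IsODESolution.pi {ι : Type*} [Fintype ι] {x f : ι → ℝ → E}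
    (h : ∀ i, IsODESolution (x i) (f i)) :
    IsODESolution (fun t i => x i t) (fun t i => f i t) :=
  ⟨fun a b => .pi fun i => (h i).1 a b, by
    filter_upwards [ae_all_iff.2 fun i => (h i).2] with t ht using hasDerivAt_pi.2 ht⟩

theorem IsODESolution.congr_ae {x f g : ℝ → E} (h : IsODESolution x f) (hfg : f =ᵐ[volume] g) :
    IsODESolution x g :=
  ⟨h.1, by filter_upwards [h.2, hfg] with t ht hft using hft ▸ ht⟩

theorem IsODESolution.continuous {x f : ℝ → E} (h : IsODESolution x f) : Continuous x := by
  rw [continuous_iff_continuousAt]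
  intro t
  refine ((h.1 (t - 1) (t + 1)).continuousOn).continuousAt ?_
  rw [uIcc_of_le (by linarith)]
  exact Icc_mem_nhds (by linarith) (by linarith)

/-- A Carathéodory solution whose derivative is almost everywhere equal to a continuous function
is a classical solution. -/
theorem IsODESolution.hasDerivAt [CompleteSpace E] {x f : ℝ → E} (h : IsODESolution x f)
    (hf : Continuous f) (t : ℝ) : HasDerivAt x (f t) t := by
  -- `x - g` is absolutely continuous with derivative zero almost everywhere, hence constant.
  set g : ℝ → E := fun t => ∫ s in (0 : ℝ)..t, f s with hg
  have hgd (t : ℝ) : HasDerivAt g (f t) t := hf.integral_hasStrictDerivAt 0 t |>.hasDerivAt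
  have hgc : ContDiff ℝ 1 g := by
    rw [contDiff_one_iff_deriv]
    refine ⟨fun t => (hgd t).differentiableAt, ?_⟩
    rwa [show deriv g = f from funext fun t => (hgd t).deriv]
  have hconst (s : ℝ) : x s - g s = x 0 - g 0 := by
    obtain ⟨C, hC⟩ := ((h.1 0 s).sub
      hgc.contDiffOn.absolutelyContinuousOnInterval).const_of_ae_hasDerivAt_zero (by
        filter_upwards [h.2] with r hr _
        simpa using hr.sub (hgd r))
    have h1 := hC s right_mem_uIcc
    have h0 := hC 0 left_mem_uIcc
    simp only [Pi.sub_apply] at h1 h0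
    rw [h1, h0]
  have hx : x = fun s => g s + (x 0 - g 0) := by
    funext s
    rw [← hconst s]; abel
  rw [hx]
  exact (hgd t).add_const _

end Caratheodory

/-! ### Necessity of joint partial detectability. -/

/-- A network that achieves omniscience estimates the functional `z` of an unobservable solution
by zero. -/
theorem DistributedEstimator.AchievesOmniscience.jointlyPartiallyDetectable
    {n m r l q : ℕ} {p : Fin l → ℕ} (hl : 0 < l) {S : DistributedSystem n m r l p}
    {G : Digraph (Fin l)} {O : DistributedEstimator q m r l p}
    (hO : O.AchievesOmniscience G S) : S.JointlyPartiallyDetectable := by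
  intro x₁ x₂ u y z₁ z₂ h₁ h₂
  have hzero {k : ℕ} : LocallyIntegrable (fun _ : ℝ => (0 : Fin k → ℝ)) volume :=
    continuous_const.locallyIntegrable
  -- The order `x₂ - x₁` is chosen so that the error `0 - (z₂ - z₁)` of the resting network is `z₁ -
  -- z₂`.
  have hS : S.IsSolution (fun t => x₂ t - x₁ t) (fun _ => 0) (fun _ _ => 0)
      (fun t => z₂ t - z₁ t) :=
    { locallyIntegrable_x := h₂.locallyIntegrable_x.sub h₁.locallyIntegrable_x
      locallyIntegrable_u := hzero
      locallyIntegrable_y := fun _ => hzero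
      locallyIntegrable_z := h₂.locallyIntegrable_z.sub h₁.locallyIntegrable_z
      state := by
        refine (h₂.state.sub h₁.state).congr_ae (Eventually.of_forall fun t => ?_)
        simp [DistributedSystem.stacked, Matrix.mulVec_sub]
      output := by
        intro i
        filter_upwards [h₁.output, h₂.output] with t ht₁ ht₂
        rw [Matrix.mulVec_zero, add_zero, Matrix.mulVec_sub, eq_comm, sub_eq_zero]
        funext k
        have h := congrFun (ht₂.symm.trans ht₁) ⟨i, k⟩
        simpa [DistributedSystem.stacked, Matrix.mulVec, dotProduct] using h
      functional := by
        filter_upwards [h₁.functional, h₂.functional] with t ht₁ ht₂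
        rw [ht₁, ht₂, Matrix.mulVec_sub]
        rfl }
  have hW : O.IsSolution G (fun _ _ => 0) (fun _ => 0) (fun _ _ => 0) (fun _ _ => 0) :=
    { locallyIntegrable_w := fun _ => hzero
      locallyIntegrable_u := hzero
      locallyIntegrable_y := fun _ => hzero
      locallyIntegrable_zhat := fun _ => hzero
      state := fun i =>
        ⟨fun a b => contDiffOn_const.absolutelyContinuousOnInterval,
          Eventually.of_forall fun t => by simpa using hasDerivAt_const t (0 : Fin q → ℝ)⟩
      estimate := fun i => Eventually.of_forall fun t => by simp }
  simpa using hO _ _ _ _ _ _ hS hW ⟨0, hl⟩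

theorem dotProduct_self_nonneg {q : ℕ} (v : Fin q → ℝ) : 0 ≤ v ⬝ᵥ v :=
  Finset.sum_nonneg fun i _ => mul_self_nonneg (v i)

/-! ### Graph Laplacian and disagreement. -/

namespace CommGraph

variable {l : ℕ} {G : Digraph (Fin l)}

theorem adjacency_nonneg (G : Digraph (Fin l)) (i j : Fin l) : 0 ≤ adjacency G i j := by
  unfold adjacency
  simp only [Matrix.of_apply]
  split_ifs <;> norm_num

theorem adjacency_of_adj {i j : Fin l} (h : G.Adj j i) : adjacency G i j = 1 := by
  simp [adjacency, h]

theorem Undirected.balanced (h : Undirected G) : Balanced G := fun i =>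
  Finset.sum_congr rfl fun j _ => by
    by_cases hij : G.Adj i j
    · simp [adjacency, hij, h _ _ hij]
    · have hji : ¬G.Adj j i := fun hji => hij (h _ _ hji)
      simp [adjacency, hij, hji]

theorem StronglyConnected.connected (h : StronglyConnected G) : Connected G := fun i j hij =>
  Relation.TransGen.mono (fun _ _ => Or.inl) _ _ (h i j hij)

/-- `∑ᵢⱼ γᵢⱼ ‖eᵢ - eⱼ‖²`. -/
noncomputable def disagreement {q : ℕ} (G : Digraph (Fin l)) (e : Fin l → Fin q → ℝ) : ℝ :=
  ∑ i, ∑ j, adjacency G i j * ((e i - e j) ⬝ᵥ (e i - e j))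

variable {q : ℕ}

theorem disagreement_nonneg (G : Digraph (Fin l)) (e : Fin l → Fin q → ℝ) :
    0 ≤ disagreement G e :=
  Finset.sum_nonneg fun i _ => Finset.sum_nonneg fun j _ =>
    mul_nonneg (adjacency_nonneg G i j) (dotProduct_self_nonneg _)

theorem disagreement_smul (G : Digraph (Fin l)) (c : ℝ) (e : Fin l → Fin q → ℝ) :
    disagreement G (c • e) = c ^ 2 * disagreement G e := by
  simp only [disagreement, Finset.mul_sum, Pi.smul_apply, ← smul_sub, smul_dotProduct,
    dotProduct_smul, smul_eq_mul]
  refine Finset.sum_congr rfl fun i _ => Finset.sum_congr rfl fun j _ => ?_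
  ring

theorem continuous_disagreement (G : Digraph (Fin l)) :
    Continuous fun e : Fin l → Fin q → ℝ => disagreement G e := by
  unfold disagreement dotProduct
  fun_prop

/-- On a balanced graph the Laplacian is dissipative. -/
theorem Balanced.two_mul_sum_dotProduct (h : Balanced G) (e : Fin l → Fin q → ℝ) :
    2 * ∑ i, e i ⬝ᵥ ∑ j, adjacency G i j • (e j - e i) = -disagreement G e := by
  -- Balancedness enters here: column sums may be replaced by row sums.
  have hswap : ∑ i, ∑ j, adjacency G i j * (e j ⬝ᵥ e j)
      = ∑ i, ∑ j, adjacency G i j * (e i ⬝ᵥ e i) := by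
    rw [Finset.sum_comm]
    refine Finset.sum_congr rfl fun i _ => ?_
    rw [← Finset.sum_mul, ← Finset.sum_mul, h i]
  have hexp : disagreement G e = ∑ i, ∑ j, adjacency G i j * (e i ⬝ᵥ e i)
      + ∑ i, ∑ j, adjacency G i j * (e j ⬝ᵥ e j)
      - 2 * ∑ i, ∑ j, adjacency G i j * (e i ⬝ᵥ e j) := by
    simp only [disagreement, Finset.mul_sum, ← Finset.sum_add_distrib, ← Finset.sum_sub_distrib]
    refine Finset.sum_congr rfl fun i _ => Finset.sum_congr rfl fun j _ => ?_
    rw [sub_dotProduct, dotProduct_sub, dotProduct_sub, dotProduct_comm (e j) (e i)]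
    ring
  have hl : ∑ i, e i ⬝ᵥ ∑ j, adjacency G i j • (e j - e i)
      = ∑ i, ∑ j, adjacency G i j * (e i ⬝ᵥ e j)
        - ∑ i, ∑ j, adjacency G i j * (e i ⬝ᵥ e i) := by
    simp only [← Finset.sum_sub_distrib]
    refine Finset.sum_congr rfl fun i _ => ?_
    rw [dotProduct_sum]
    refine Finset.sum_congr rfl fun j _ => ?_
    rw [dotProduct_smul, dotProduct_sub, smul_eq_mul]
    ring
  rw [hl, hexp, hswap]
  ring

theorem Connected.eq_of_disagreement_eq_zero (h : Connected G) {e : Fin l → Fin q → ℝ}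
    (he : disagreement G e = 0) (i j : Fin l) : e i = e j := by
  have hadj {i j : Fin l} (hij : G.Adj j i) : e i = e j := by
    have h1 := (Finset.sum_eq_zero_iff_of_nonneg fun i _ => Finset.sum_nonneg fun j _ =>
      mul_nonneg (adjacency_nonneg G i j) (dotProduct_self_nonneg _)).1 he i (Finset.mem_univ i)
    have h2 := (Finset.sum_eq_zero_iff_of_nonneg fun j _ =>
      mul_nonneg (adjacency_nonneg G i j) (dotProduct_self_nonneg _)).1 h1 j (Finset.mem_univ j)
    rw [adjacency_of_adj hij, one_mul, dotProduct_self_eq_zero] at h2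
    exact sub_eq_zero.1 h2
  rcases eq_or_ne i j with rfl | hij
  · rfl
  induction h i j hij with
  | single h => exact h.elim (fun h => (hadj h).symm) hadj
  | tail _ h ih =>
    rename_i b c _
    have hbc : e b = e c := h.elim (fun h => (hadj h).symm) hadj
    -- The walk may revisit `i`, where the induction hypothesis, which requires distinct endpoints,
    -- says nothing.
    rcases eq_or_ne i b with rfl | hib
    · exact hbc
    · exact (ih hib).trans hbc

end CommGraph

/-! ### Quadratic forms for the design. -/

section LyapunovDesign

variable {q : ℕ}

theorem dotProduct_self_pos {v : Fin q → ℝ} (hv : v ≠ 0) : 0 < v ⬝ᵥ v :=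
  lt_of_le_of_ne (dotProduct_self_nonneg v) fun h => hv (dotProduct_self_eq_zero.1 h.symm)

/-- A large `β` dominates `-(v ⬝ᵥ A v)`. Time reversal plus this shift gives a solvable Lyapunov
equation for arbitrary `A`. -/
theorem exists_asymptoticallyStable_neg_sub (A : (Fin q → ℝ) →ₗ[ℝ] (Fin q → ℝ)) :
    ∃ β : ℝ, 0 < β ∧ AsymptoticallyStable (-A - β • LinearMap.id) := by
  have hA : Continuous A := A.continuous_of_finiteDimensional
  obtain ⟨g, hg, h⟩ := exists_pos_lt_mul_of_homogeneous (E := Fin q → ℝ)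
    (f := fun v => -(v ⬝ᵥ A v)) (h := fun v => v ⬝ᵥ v)
    (by unfold dotProduct; fun_prop) (by unfold dotProduct; fun_prop)
    (fun c v => by simp; ring) (fun c v => by simp; ring) dotProduct_self_nonneg
    (fun v hv h0 => absurd h0 (dotProduct_self_pos hv).ne')
  refine ⟨g, hg, asymptoticallyStable_of_lyapunov _ (dotProductBilin ℝ ℝ)
    (fun v hv => dotProduct_self_pos hv) fun v hv => ?_⟩
  have h1 := h v hv
  have h2 : dotProductBilin ℝ ℝ v ((-A - g • LinearMap.id : (Fin q → ℝ) →ₗ[ℝ] (Fin q → ℝ)) v)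
      = -(v ⬝ᵥ A v) - g * (v ⬝ᵥ v) := by
    change v ⬝ᵥ (-A v - g • v) = _
    simp
  have h3 : dotProductBilin ℝ ℝ ((-A - g • LinearMap.id : (Fin q → ℝ) →ₗ[ℝ] (Fin q → ℝ)) v) v
      = -(v ⬝ᵥ A v) - g * (v ⬝ᵥ v) := by
    rw [← h2]; exact dotProduct_comm (-A v - g • v) v
  rw [h2, h3]
  linarith

/-- A positive semidefinite form, with kernel in the unobservable subspace of `(A, C)`, that
output injection makes strictly decreasing off its kernel. -/
theorem exists_observability_form {p : ℕ} (A : (Fin q → ℝ) →ₗ[ℝ] (Fin q → ℝ))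
    (C : (Fin q → ℝ) →ₗ[ℝ] (Fin p → ℝ)) :
    ∃ (P : LinearMap.BilinForm ℝ (Fin q → ℝ)) (β : ℝ), 0 < β ∧ (∀ x y, P x y = P y x) ∧
      (∀ x, 0 ≤ P x x) ∧ (∀ x, 2 * P x (A x) = C x ⬝ᵥ C x - 2 * β * P x x) ∧
      ∀ v, P v v = 0 → ∀ k : ℕ, C ((A ^ k) v) = 0 := by
  obtain ⟨β, hβ, hF⟩ := exists_asymptoticallyStable_neg_sub A
  obtain ⟨P, hs, h0, hP⟩ := hF.exists_lyapunov ((dotProductBilin ℝ ℝ).compl₁₂ C C)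
    (fun x y => dotProduct_comm _ _) (fun x => dotProduct_self_nonneg _)
  -- The Lyapunov equation for `-A - β` with right side `-CᵀC`, rewritten for `A`. On the kernel of
  -- `P` it forces `C w = 0`, and then `A w` is in the kernel too.
  have hP' (x y : Fin q → ℝ) : P (A x) y + P x (A y) = C x ⬝ᵥ C y - 2 * β * P x y := by
    have h := hP x y
    simp only [LinearMap.sub_apply, LinearMap.neg_apply, LinearMap.smul_apply,
      LinearMap.id_apply, map_sub, map_neg, map_smul, smul_eq_mul] at h
    have h' : ((dotProductBilin ℝ ℝ).compl₁₂ C C) x y = C x ⬝ᵥ C y := rfl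
    rw [h'] at h
    linarith
  refine ⟨P, β, hβ, hs, h0, fun x => ?_, fun v hv k => ?_⟩
  · have := hP' x x
    rw [hs (A x) x] at this
    linarith
  have hker {w : Fin q → ℝ} (hw : P w w = 0) : C w = 0 := by
    have h := hP' w w
    rw [hs (A w) w, P.eq_zero_of_self_eq_zero hs h0 hw, hw] at h
    exact dotProduct_self_eq_zero.1 (by linarith)
  have hinv {w : Fin q → ℝ} (hw : P w w = 0) : P (A w) (A w) = 0 := by
    have h := hP' w (A w)
    rw [P.eq_zero_of_self_eq_zero hs h0 hw, P.eq_zero_of_self_eq_zero hs h0 hw, hker hw] at h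
    simpa using h
  refine hker ?_
  induction k with
  | zero => simpa using hv
  | succ k ih => rw [pow_succ']; exact hinv ih

/-- If all solutions of `ẋ = A x` in an invariant subspace tend to zero, then there is a positive
definite form that decreases strictly along them. -/
theorem exists_form_decreasing_on (A : (Fin q → ℝ) →ₗ[ℝ] (Fin q → ℝ))
    (N : Submodule ℝ (Fin q → ℝ)) (hN : ∀ v ∈ N, A v ∈ N)
    (hA : ∀ x : ℝ → Fin q → ℝ, x 0 ∈ N → (∀ t, HasDerivAt x (A (x t)) t) →
      Tendsto x atTop (𝓝 0)) :
    ∃ Q : LinearMap.BilinForm ℝ (Fin q → ℝ), (∀ x y, Q x y = Q y x) ∧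
      (∀ v, v ≠ 0 → 0 < Q v v) ∧ ∀ v ∈ N, v ≠ 0 → Q v (A v) < 0 := by
  obtain ⟨g, hg⟩ := LinearMap.exists_leftInverse_of_injective N.subtype N.ker_subtype
  set π : (Fin q → ℝ) →ₗ[ℝ] (Fin q → ℝ) := N.subtype ∘ₗ g with hπ
  have hπN (v : Fin q → ℝ) : π v ∈ N := (g v).2
  have hπv {v : Fin q → ℝ} (hv : v ∈ N) : π v = v :=
    congrArg Subtype.val (LinearMap.congr_fun hg ⟨v, hv⟩)
  -- `F` agrees with `A` on `N`, and `x - π x` decays like `exp(-t)` along its solutions. Thus `F`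
  -- is stable on the whole space, and its Lyapunov form serves on `N`.
  set F : (Fin q → ℝ) →ₗ[ℝ] (Fin q → ℝ) := A ∘ₗ π - (LinearMap.id - π) with hFdef
  have hFv (v : Fin q → ℝ) : F v = A (π v) - (v - π v) := rfl
  have hneg : AsymptoticallyStable (-LinearMap.id : (Fin q → ℝ) →ₗ[ℝ] (Fin q → ℝ)) := by
    refine asymptoticallyStable_of_lyapunov _ (dotProductBilin ℝ ℝ)
      (fun v hv => dotProduct_self_pos hv) fun v hv => ?_
    have := dotProduct_self_pos hv
    change v ⬝ᵥ (-v) + (-v) ⬝ᵥ v < 0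
    simp only [dotProduct_neg, neg_dotProduct]
    linarith
  have hF : AsymptoticallyStable F := by
    intro x hx
    have hd (t : ℝ) : HasDerivAt (fun t => π (x t)) (A (π (x t))) t := by
      have h := (LinearMap.toContinuousLinearMap π).hasFDerivAt.comp_hasDerivAt t (hx t)
      have he : π (F (x t)) = A (π (x t)) := by
        rw [hFv, map_sub, map_sub, hπv (hN _ (hπN _)), hπv (hπN _), sub_self, sub_zero]
      rw [← he]
      exact h
    have h1 := hA _ (hπN _) hd
    have h2 := hneg (fun t => x t - π (x t)) fun t => by
      refine ((hx t).sub (hd t)).congr_deriv ?_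
      rw [hFv]
      simp
    simpa using h1.add h2
  obtain ⟨Q, hs, h0, hQ⟩ := hF.exists_lyapunov (dotProductBilin ℝ ℝ)
    (fun x y => dotProduct_comm x y) (fun x => dotProduct_self_nonneg _)
  have hQv (v : Fin q → ℝ) : 2 * Q v (F v) = -(v ⬝ᵥ v) := by
    have h : Q (F v) v + Q v (F v) = -(v ⬝ᵥ v) := hQ v v
    rw [hs (F v) v] at h
    linarith
  refine ⟨Q, hs, fun v hv => lt_of_le_of_ne (h0 v) fun h => ?_, fun v hvN hv => ?_⟩
  · have h1 := hQv v
    rw [Q.eq_zero_of_self_eq_zero hs h0 h.symm] at h1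
    linarith [dotProduct_self_pos hv]
  · have h1 := hQv v
    rw [hFv, hπv hvN, sub_self, sub_zero] at h1
    linarith [dotProduct_self_pos hv]

/-- `M` is the inverse Gram matrix of `P`, which exists because a definite form is nondegenerate. As
a gain it cancels the form in the Lyapunov derivative. -/
theorem exists_matrix_form_eq_dotProduct (P : LinearMap.BilinForm ℝ (Fin q → ℝ))
    (hP : ∀ v, v ≠ 0 → 0 < P v v) (hs : ∀ x y, P x y = P y x) :
    ∃ M : Matrix (Fin q) (Fin q) ℝ, ∀ x y, P x (M *ᵥ y) = x ⬝ᵥ y := by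
  have hker : LinearMap.ker P = ⊥ := by
    rw [LinearMap.ker_eq_bot']
    intro v hv
    by_contra h
    exact (hP v h).ne' (by rw [hv]; rfl)
  have hsurj : Function.Surjective P := by
    rw [← LinearMap.injective_iff_surjective_of_finrank_eq_finrank
      (Subspace.dual_finrank_eq (K := ℝ) (V := Fin q → ℝ)).symm]
    exact LinearMap.ker_eq_bot.1 hker
  obtain ⟨g, hg⟩ := P.exists_rightInverse_of_surjective (LinearMap.range_eq_top.2 hsurj)
  refine ⟨LinearMap.toMatrix' (g ∘ₗ dotProductBilin ℝ ℝ), fun x y => ?_⟩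
  rw [LinearMap.toMatrix'_mulVec, hs, dotProduct_comm]
  exact LinearMap.congr_fun (LinearMap.congr_fun hg (dotProductBilin ℝ ℝ y)) x

end LyapunovDesign

/-! ### Stabilization of the estimation errors. -/

section ErrorSystem

variable {q l : ℕ} {p : Fin l → ℕ}

/-- The dynamics `ėᵢ = A eᵢ - Lᵢ Cᵢ eᵢ + γ Mᵢ ∑ⱼ γᵢⱼ (eⱼ - eᵢ)` of the estimation errors. -/
noncomputable def errorMap (G : Digraph (Fin l)) (A : Matrix (Fin q) (Fin q) ℝ)
    (C : (i : Fin l) → Matrix (Fin (p i)) (Fin q) ℝ)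
    (L : (i : Fin l) → Matrix (Fin q) (Fin (p i)) ℝ) (M : Fin l → Matrix (Fin q) (Fin q) ℝ)
    (γ : ℝ) : (Fin l → Fin q → ℝ) →ₗ[ℝ] (Fin l → Fin q → ℝ) where
  toFun e i := A *ᵥ e i - L i *ᵥ (C i *ᵥ e i)
    + γ • (M i *ᵥ ∑ j, CommGraph.adjacency G i j • (e j - e i))
  map_add' e e' := by
    funext i
    have h : ∑ j, CommGraph.adjacency G i j • (e j + e' j - (e i + e' i))
        = ∑ j, CommGraph.adjacency G i j • (e j - e i)
          + ∑ j, CommGraph.adjacency G i j • (e' j - e' i) := by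
      rw [← Finset.sum_add_distrib]
      refine Finset.sum_congr rfl fun j _ => ?_
      rw [← smul_add, add_sub_add_comm]
    simp only [Pi.add_apply, h, Matrix.mulVec_add, smul_add]
    abel
  map_smul' c e := by
    funext i
    have h : ∑ j, CommGraph.adjacency G i j • (c • e j - c • e i)
        = c • ∑ j, CommGraph.adjacency G i j • (e j - e i) := by
      rw [Finset.smul_sum]
      refine Finset.sum_congr rfl fun j _ => ?_
      rw [← smul_sub, smul_comm]
    simp only [Pi.smul_apply, h, Matrix.mulVec_smul, RingHom.id_apply]
    rw [smul_add, smul_sub, smul_comm γ c]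

/-- Gains that stabilize the estimation errors, when the joint unobservable dynamics is stable. -/
theorem exists_asymptoticallyStable_errorMap (hl : 0 < l) {G : Digraph (Fin l)}
    (hbal : CommGraph.Balanced G) (hcon : CommGraph.Connected G)
    (A : Matrix (Fin q) (Fin q) ℝ) (C : (i : Fin l) → Matrix (Fin (p i)) (Fin q) ℝ)
    (hdet : ∀ x : ℝ → Fin q → ℝ, (∀ i (k : ℕ), C i *ᵥ (A ^ k *ᵥ x 0) = 0) →
      (∀ t, HasDerivAt x (A *ᵥ x t) t) → Tendsto x atTop (𝓝 0)) :
    ∃ (L : (i : Fin l) → Matrix (Fin q) (Fin (p i)) ℝ) (M : Fin l → Matrix (Fin q) (Fin q) ℝ)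
      (γ : ℝ), 0 < γ ∧ AsymptoticallyStable (errorMap G A C L M γ) := by
  have hpow (k : ℕ) (v : Fin q → ℝ) : (A.mulVecLin ^ k) v = A ^ k *ᵥ v := by
    rw [← Matrix.toLin'_apply', ← Matrix.toLin'_pow, Matrix.toLin'_apply]
  choose P β hβ hPs hP0 hPA hPker using
    fun i => exists_observability_form A.mulVecLin (C i).mulVecLin
  simp only [hpow, Matrix.mulVecLin_apply] at hPA hPker
  set N : Submodule ℝ (Fin q → ℝ) :=
    ⨅ (i : Fin l) (k : ℕ), LinearMap.ker ((C i).mulVecLin ∘ₗ (A ^ k).mulVecLin) with hNdef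
  have hN (v : Fin q → ℝ) : v ∈ N ↔ ∀ i (k : ℕ), C i *ᵥ (A ^ k *ᵥ v) = 0 := by
    simp only [hNdef, Submodule.mem_iInf, LinearMap.mem_ker]
    rfl
  obtain ⟨Q, hQs, hQ0, hQN⟩ := exists_form_decreasing_on A.mulVecLin N
    (fun v hv => (hN _).2 fun i k => by
      have := (hN v).1 hv i (k + 1)
      rwa [pow_succ, ← Matrix.mulVec_mulVec] at this)
    (fun x hx hd => hdet x ((hN _).1 hx) hd)
  simp only [Matrix.mulVecLin_apply] at hQN
  have hAc : Continuous fun v : Fin q → ℝ => A *ᵥ v :=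
    Continuous.matrix_mulVec continuous_const continuous_id
  -- At a consensus vector `eᵢ = v` the local terms add up to `l · 2Q(v, Av) - g ∑ 2βᵢ Pᵢ(v, v)`. If
  -- all `Pᵢ(v, v)` vanish, `v` lies in `N`, where `Q(v, Av) < 0` for `v ≠ 0`.
  obtain ⟨g, hg, hgain⟩ := exists_pos_lt_mul_of_homogeneous
    (f := fun v => l * (2 * Q v (A *ᵥ v))) (h := fun v => ∑ i, 2 * β i * P i v v)
    (continuous_const.mul (continuous_const.mul (Q.continuous_comp continuous_id hAc)))
    (continuous_finsetSum _ fun i _ =>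
      continuous_const.mul ((P i).continuous_comp continuous_id continuous_id))
    (fun c v => by simp [Matrix.mulVec_smul]; ring)
    (fun c v => by
      rw [Finset.mul_sum]
      refine Finset.sum_congr rfl fun i _ => ?_
      simp; ring)
    (fun v => Finset.sum_nonneg fun i _ =>
      mul_nonneg (mul_nonneg zero_le_two (hβ i).le) (hP0 i v))
    (fun v hv h => by
      have hl' : (0 : ℝ) < l := by exact_mod_cast hl
      have hi (i : Fin l) : P i v v = 0 := by
        have := (Finset.sum_eq_zero_iff_of_nonneg fun i _ =>
          mul_nonneg (mul_nonneg zero_le_two (hβ i).le) (hP0 i v)).1 h i (Finset.mem_univ i)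
        exact (mul_eq_zero.1 this).resolve_left (mul_pos two_pos (hβ i)).ne'
      have := hQN v ((hN v).2 fun i k => hPker i v (hi i) k) hv
      exact mul_neg_of_pos_of_neg hl' (by linarith))
  set R : Fin l → LinearMap.BilinForm ℝ (Fin q → ℝ) := fun i => g • P i + Q with hRdef
  have hR (i : Fin l) (x y : Fin q → ℝ) : R i x y = g * P i x y + Q x y := rfl
  have hRpos (i : Fin l) (v : Fin q → ℝ) (hv : v ≠ 0) : 0 < R i v v := by
    rw [hR]
    exact add_pos_of_nonneg_of_pos (mul_nonneg hg.le (hP0 i v)) (hQ0 v hv)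
  have hRs (i : Fin l) (x y : Fin q → ℝ) : R i x y = R i y x := by
    rw [hR, hR, hPs, hQs]
  choose M hM using fun i => exists_matrix_form_eq_dotProduct (R i) (hRpos i) (hRs i)
  set f : (Fin l → Fin q → ℝ) → ℝ :=
    fun e => ∑ i, (2 * Q (e i) (A *ᵥ e i) - g * (2 * β i * P i (e i) (e i))) with hfdef
  -- By connectedness the disagreement vanishes only at consensus, where `f < 0` by the choice of
  -- `g`.
  obtain ⟨γ, hγ, hcoupling⟩ := exists_pos_lt_mul_of_homogeneous (f := f)
    (h := fun e => CommGraph.disagreement G e)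
    (continuous_finsetSum _ fun i _ => by
      have he : Continuous fun e : Fin l → Fin q → ℝ => e i := continuous_apply i
      exact (continuous_const.mul (Q.continuous_comp he (hAc.comp he))).sub
        (continuous_const.mul (continuous_const.mul ((P i).continuous_comp he he))))
    (CommGraph.continuous_disagreement G)
    (fun c e => by
      simp only [hfdef, Finset.mul_sum]
      refine Finset.sum_congr rfl fun i _ => ?_
      simp [Matrix.mulVec_smul]; ring)
    (CommGraph.disagreement_smul G) (CommGraph.disagreement_nonneg G)
    (fun e he h => by
      have hv (i : Fin l) : e i = e ⟨0, hl⟩ := hcon.eq_of_disagreement_eq_zero h i _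
      have hv0 : e ⟨0, hl⟩ ≠ 0 := fun h0 => he (funext fun i => (hv i).trans h0)
      have := hgain _ hv0
      simp only [hfdef, hv, Finset.sum_sub_distrib, ← Finset.mul_sum, Finset.sum_const,
        Finset.card_univ, Fintype.card_fin, nsmul_eq_mul]
      linarith)
  refine ⟨fun i => (g / 2) • (M i * (C i)ᵀ), M, γ, hγ,
    asymptoticallyStable_of_lyapunov _
      (∑ i, (R i).compl₁₂ (LinearMap.proj i) (LinearMap.proj i)) ?_ ?_⟩
  · intro e he
    obtain ⟨i, hi⟩ := Function.ne_iff.1 he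
    rw [LinearMap.sum_apply, LinearMap.sum_apply]
    refine Finset.sum_pos' (fun j _ => ?_) ⟨i, Finset.mem_univ i, hRpos i _ hi⟩
    rcases eq_or_ne (e j) 0 with h | h
    · simp [h]
    · exact (hRpos j _ h).le
  · intro e he
    have hBs (x y : Fin l → Fin q → ℝ) :
        (∑ i, (R i).compl₁₂ (LinearMap.proj i) (LinearMap.proj i) :
          LinearMap.BilinForm ℝ (Fin l → Fin q → ℝ)) x y = ∑ i, R i (x i) (y i) := by
      rw [LinearMap.sum_apply, LinearMap.sum_apply]
      rfl
    -- The injection term contributes `-g ‖Cᵢ eᵢ‖²`, which is why its gain carries `g / 2`. It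
    -- cancels the positive term of `2g Pᵢ(eᵢ, A eᵢ)` exactly.
    have hnode (i : Fin l) : 2 * R i (e i) (errorMap G A C
        (fun i => (g / 2) • (M i * (C i)ᵀ)) M γ e i)
        = (2 * Q (e i) (A *ᵥ e i) - g * (2 * β i * P i (e i) (e i)))
          + γ * (2 * (e i ⬝ᵥ ∑ j, CommGraph.adjacency G i j • (e j - e i))) := by
      have hadj : e i ⬝ᵥ (C i)ᵀ *ᵥ (C i *ᵥ e i) = (C i *ᵥ e i) ⬝ᵥ (C i *ᵥ e i) := by
        rw [Matrix.dotProduct_mulVec, Matrix.vecMul_transpose]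
      have h := hPA i (e i)
      change 2 * R i (e i) (A *ᵥ e i - ((g / 2) • (M i * (C i)ᵀ)) *ᵥ (C i *ᵥ e i)
        + γ • (M i *ᵥ ∑ j, CommGraph.adjacency G i j • (e j - e i))) = _
      rw [map_add, map_sub, map_smul, hM, Matrix.smul_mulVec, map_smul, ← Matrix.mulVec_mulVec,
        hM, hadj, hR]
      simp only [smul_eq_mul]
      linear_combination g * h
    have hsum := hbal.two_mul_sum_dotProduct e
    rw [hBs, hBs, Finset.sum_congr rfl fun i _ => hRs i _ (e i), ← two_mul, Finset.mul_sum,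
      Finset.sum_congr rfl fun i _ => hnode i, Finset.sum_add_distrib, ← Finset.mul_sum,
      ← Finset.mul_sum, hsum]
    have := hcoupling e he
    simp only [hfdef] at this
    linarith

end ErrorSystem

/-! ### Quotients by invariant subspaces, in matrix form. -/

section Quotient

variable {n : ℕ}

/-- A subspace of `ℝⁿ` is the kernel of a matrix with a right inverse. -/
theorem exists_matrix_ker_eq (N : Submodule ℝ (Fin n → ℝ)) :
    ∃ (q : ℕ) (T : Matrix (Fin q) (Fin n) ℝ) (T' : Matrix (Fin n) (Fin q) ℝ),
      T * T' = 1 ∧ ∀ v, T *ᵥ v = 0 ↔ v ∈ N := by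
  set φ := (Module.finBasis ℝ ((Fin n → ℝ) ⧸ N)).equivFun with hφ
  set f := φ.toLinearMap ∘ₗ N.mkQ with hf
  obtain ⟨g, hg⟩ := f.exists_rightInverse_of_surjective
    (LinearMap.range_eq_top.2 (φ.surjective.comp N.mkQ_surjective))
  refine ⟨_, LinearMap.toMatrix' f, LinearMap.toMatrix' g, ?_, fun v => ?_⟩
  · rw [← LinearMap.toMatrix'_comp, hg, LinearMap.toMatrix'_id]
  · rw [LinearMap.toMatrix'_mulVec]
    change φ (N.mkQ v) = 0 ↔ _
    rw [φ.map_eq_zero_iff, Submodule.mkQ_apply, Submodule.Quotient.mk_eq_zero]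

variable {q k : ℕ} {T : Matrix (Fin q) (Fin n) ℝ} {T' : Matrix (Fin n) (Fin q) ℝ}

/-- `T' T v - v` lies in the kernel of `T`, so `X` cannot see it. Hence `X T'` is the matrix induced
by `X` on the quotient. -/
theorem Matrix.mul_rightInverse_mul_eq (hT : T * T' = 1) (X : Matrix (Fin k) (Fin n) ℝ)
    (hX : ∀ v, T *ᵥ v = 0 → X *ᵥ v = 0) : X * T' * T = X := by
  refine Matrix.ext_of_mulVec_single fun i => ?_
  set v : Fin n → ℝ := Pi.single i 1
  have h : X *ᵥ (T' *ᵥ (T *ᵥ v) - v) = 0 := hX _ <| by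
    rw [Matrix.mulVec_sub, Matrix.mulVec_mulVec, hT, Matrix.one_mulVec, sub_self]
  rw [Matrix.mulVec_sub, sub_eq_zero] at h
  rw [← Matrix.mulVec_mulVec, ← Matrix.mulVec_mulVec, h]

theorem Matrix.pow_mul_intertwine {A : Matrix (Fin n) (Fin n) ℝ} {A' : Matrix (Fin q) (Fin q) ℝ}
    (h : A' * T = T * A) (j : ℕ) : A' ^ j * T = T * A ^ j := by
  induction j with
  | zero => simp
  | succ j ih => rw [pow_succ, Matrix.mul_assoc, h, ← Matrix.mul_assoc, ih, Matrix.mul_assoc,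
      ← pow_succ]

theorem HasDerivAt.matrix_mulVec {ι κ : Type*} [Fintype ι] [Fintype κ] {x : ℝ → ι → ℝ}
    {x' : ι → ℝ} {t : ℝ} (T : Matrix κ ι ℝ) (h : HasDerivAt x x' t) :
    HasDerivAt (fun s => T *ᵥ x s) (T *ᵥ x') t :=
  (LinearMap.toContinuousLinearMap T.mulVecLin).hasFDerivAt.comp_hasDerivAt t h

theorem eq_of_hasDerivAt_mulVec {A : Matrix (Fin n) (Fin n) ℝ} {x y : ℝ → Fin n → ℝ}
    (hx : ∀ t, HasDerivAt x (A *ᵥ x t) t) (hy : ∀ t, HasDerivAt y (A *ᵥ y t) t)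
    (h : x 0 = y 0) : x = y :=
  ODE_solution_unique_univ (v := fun _ z => A *ᵥ z) (s := fun _ => univ)
    (fun _ => ((LinearMap.toContinuousLinearMap A.mulVecLin).lipschitz).lipschitzOnWith)
    (fun t => ⟨hx t, mem_univ _⟩) (fun t => ⟨hy t, mem_univ _⟩) h

/-- Invariant subspaces are invariant under the flow. -/
theorem mem_of_hasDerivAt_mulVec {A : Matrix (Fin n) (Fin n) ℝ} {W : Submodule ℝ (Fin n → ℝ)}
    (hW : ∀ v ∈ W, A *ᵥ v ∈ W) {x : ℝ → Fin n → ℝ} (hx : ∀ t, HasDerivAt x (A *ᵥ x t) t)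
    (h0 : x 0 ∈ W) (t : ℝ) : x t ∈ W := by
  obtain ⟨q, T, T', hT, hker⟩ := exists_matrix_ker_eq W
  have hA : T * A * T' * T = T * A := Matrix.mul_rightInverse_mul_eq hT _ fun v hv => by
    rw [← Matrix.mulVec_mulVec]
    exact (hker _).2 (hW v ((hker v).1 hv))
  -- `T x` solves the induced equation on the quotient with initial value zero.
  have h : (fun s => T *ᵥ x s) = fun _ => 0 :=
    eq_of_hasDerivAt_mulVec (A := T * A * T')
      (fun s => by
        rw [Matrix.mulVec_mulVec, hA, ← Matrix.mulVec_mulVec]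
        exact (hx s).matrix_mulVec T)
      (fun s => by simpa using hasDerivAt_const s (0 : Fin q → ℝ)) ((hker _).2 h0)
  exact (hker _).1 (congrFun h t)

theorem isODESolution_of_hasDerivAt_mulVec {A : Matrix (Fin n) (Fin n) ℝ} {x : ℝ → Fin n → ℝ}
    (hx : ∀ t, HasDerivAt x (A *ᵥ x t) t) : IsODESolution x fun t => A *ᵥ x t := by
  have hc : Continuous x := continuous_iff_continuousAt.2 fun t => (hx t).continuousAt
  have hC : ContDiff ℝ 1 x := by
    rw [contDiff_one_iff_deriv]
    refine ⟨fun t => (hx t).differentiableAt, ?_⟩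
    rw [show deriv x = fun t => A *ᵥ x t from funext fun t => (hx t).deriv]
    exact Continuous.matrix_mulVec continuous_const hc
  exact ⟨fun a b => hC.contDiffOn.absolutelyContinuousOnInterval, Eventually.of_forall hx⟩

end Quotient

/-! ### From joint partial detectability to a detectable quotient. -/

namespace DistributedSystem

variable {n m r l : ℕ} {p : Fin l → ℕ} {S : DistributedSystem n m r l p}

/-- The unobservable subspace of `(A, C̃)`. -/
def unobservable (S : DistributedSystem n m r l p) : Submodule ℝ (Fin n → ℝ) :=
  ⨅ (i : Fin l) (k : ℕ), LinearMap.ker (S.C i * S.A ^ k).mulVecLin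

theorem mem_unobservable {v : Fin n → ℝ} :
    v ∈ S.unobservable ↔ ∀ i (k : ℕ), S.C i *ᵥ (S.A ^ k *ᵥ v) = 0 := by
  simp [unobservable, Submodule.mem_iInf]

theorem mulVec_mem_unobservable {v : Fin n → ℝ} (hv : v ∈ S.unobservable) :
    S.A *ᵥ v ∈ S.unobservable :=
  mem_unobservable.2 fun i k => by
    have := mem_unobservable.1 hv i (k + 1)
    rwa [pow_succ, ← Matrix.mulVec_mulVec] at this

/-- An unobservable trajectory has zero outputs, so it can be compared with the zero solution;
continuity upgrades the essential limit. -/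
theorem JointlyPartiallyDetectable.tendsto (h : S.JointlyPartiallyDetectable)
    {x : ℝ → Fin n → ℝ} (hx : ∀ t, HasDerivAt x (S.A *ᵥ x t) t) (h0 : x 0 ∈ S.unobservable) :
    Tendsto (fun t => S.K *ᵥ x t) atTop (𝓝 0) := by
  have hc : Continuous x := continuous_iff_continuousAt.2 fun t => (hx t).continuousAt
  have hKc : Continuous fun t => S.K *ᵥ x t := Continuous.matrix_mulVec continuous_const hc
  have hmem (t : ℝ) : x t ∈ S.unobservable :=
    mem_of_hasDerivAt_mulVec (fun _ => mulVec_mem_unobservable) hx h0 t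
  have hout (t : ℝ) : S.stacked.C *ᵥ x t = 0 := by
    funext ik
    have h := mem_unobservable.1 (hmem t) ik.1 0
    rw [pow_zero, Matrix.one_mulVec] at h
    exact congrFun h ik.2
  refine hKc.tendsto_zero_of_essTendstoZero ?_
  simpa using h x (fun _ => 0) (fun _ => 0) (fun _ => 0) (fun t => S.K *ᵥ x t) (fun _ => 0)
    { locallyIntegrable_x := hc.locallyIntegrable
      locallyIntegrable_u := continuous_const.locallyIntegrable
      locallyIntegrable_y := continuous_const.locallyIntegrable
      locallyIntegrable_z := hKc.locallyIntegrable
      state := by simpa [stacked] using isODESolution_of_hasDerivAt_mulVec hx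
      output := Eventually.of_forall fun t => by simp [hout]
      functional := Eventually.of_forall fun t => rfl }
    { locallyIntegrable_x := continuous_const.locallyIntegrable
      locallyIntegrable_u := continuous_const.locallyIntegrable
      locallyIntegrable_y := continuous_const.locallyIntegrable
      locallyIntegrable_z := continuous_const.locallyIntegrable
      state := ⟨fun a b => contDiffOn_const.absolutelyContinuousOnInterval,
        Eventually.of_forall fun t => by simpa using hasDerivAt_const t (0 : Fin n → ℝ)⟩
      output := Eventually.of_forall fun t => by simp
      functional := Eventually.of_forall fun t => by simp }

/-- A jointly partially detectable system has a quotient that carries its outputs and its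
functional, and on whose unobservable subspace the dynamics is stable. -/
theorem JointlyPartiallyDetectable.exists_quotient (h : S.JointlyPartiallyDetectable) :
    ∃ (q : ℕ) (T : Matrix (Fin q) (Fin n) ℝ) (A : Matrix (Fin q) (Fin q) ℝ)
      (C : (i : Fin l) → Matrix (Fin (p i)) (Fin q) ℝ) (K : Matrix (Fin r) (Fin q) ℝ),
      A * T = T * S.A ∧ (∀ i, C i * T = S.C i) ∧ K * T = S.K ∧
      ∀ x : ℝ → Fin q → ℝ, (∀ i (k : ℕ), C i *ᵥ (A ^ k *ᵥ x 0) = 0) →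
        (∀ t, HasDerivAt x (A *ᵥ x t) t) → Tendsto x atTop (𝓝 0) := by
  -- The `K Aᵏ` must be included: `K` need not vanish on the unobservable subspace, so it would not
  -- descend to the quotient by that subspace alone.
  obtain ⟨q, T, T', hT, hker⟩ := exists_matrix_ker_eq
    (S.unobservable ⊓ ⨅ k : ℕ, LinearMap.ker (S.K * S.A ^ k).mulVecLin)
  have hker' (v : Fin n → ℝ) : T *ᵥ v = 0 ↔ (∀ i (k : ℕ), S.C i *ᵥ (S.A ^ k *ᵥ v) = 0) ∧
      ∀ k : ℕ, S.K *ᵥ (S.A ^ k *ᵥ v) = 0 := by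
    rw [hker, Submodule.mem_inf, mem_unobservable]
    simp [Submodule.mem_iInf]
  have hA : T * S.A * T' * T = T * S.A := Matrix.mul_rightInverse_mul_eq hT _ fun v hv => by
    obtain ⟨h1, h2⟩ := (hker' v).1 hv
    rw [← Matrix.mulVec_mulVec, hker']
    refine ⟨fun i k => ?_, fun k => ?_⟩
    · rw [Matrix.mulVec_mulVec v, ← pow_succ]
      exact h1 i (k + 1)
    · rw [Matrix.mulVec_mulVec v, ← pow_succ]
      exact h2 (k + 1)
  have hC (i : Fin l) : S.C i * T' * T = S.C i := Matrix.mul_rightInverse_mul_eq hT _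
    fun v hv => by simpa using ((hker' v).1 hv).1 i 0
  have hK : S.K * T' * T = S.K := Matrix.mul_rightInverse_mul_eq hT _
    fun v hv => by simpa using ((hker' v).1 hv).2 0
  refine ⟨q, T, T * S.A * T', fun i => S.C i * T', S.K * T', hA, hC, hK, fun x h0 hx => ?_⟩
  set A := T * S.A * T' with hAdef
  have hTT' (v : Fin q → ℝ) : T *ᵥ (T' *ᵥ v) = v := by
    rw [Matrix.mulVec_mulVec, hT, Matrix.one_mulVec]
  have hApow (k : ℕ) (v : Fin n → ℝ) : A ^ k *ᵥ (T *ᵥ v) = T *ᵥ (S.A ^ k *ᵥ v) := by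
    rw [Matrix.mulVec_mulVec, Matrix.pow_mul_intertwine hA, Matrix.mulVec_mulVec]
  have hCv (i : Fin l) (k : ℕ) (v : Fin n → ℝ) :
      (S.C i * T') *ᵥ (A ^ k *ᵥ (T *ᵥ v)) = S.C i *ᵥ (S.A ^ k *ᵥ v) := by
    rw [hApow, Matrix.mulVec_mulVec, hC]
  have hKv (k : ℕ) (v : Fin n → ℝ) :
      (S.K * T') *ᵥ (A ^ k *ᵥ (T *ᵥ v)) = S.K *ᵥ (S.A ^ k *ᵥ v) := by
    rw [hApow, Matrix.mulVec_mulVec, hK]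
  obtain ⟨X, hX0, hX⟩ := exists_hasDerivAt_linear S.A.mulVecLin (T' *ᵥ x 0)
  simp only [Matrix.mulVecLin_apply] at hX
  have hxX : x = fun t => T *ᵥ X t := by
    refine eq_of_hasDerivAt_mulVec hx (fun t => ?_) (by rw [hX0, hTT'])
    rw [Matrix.mulVec_mulVec, hA, ← Matrix.mulVec_mulVec]
    exact (hX t).matrix_mulVec T
  have hXmem : X 0 ∈ S.unobservable := mem_unobservable.2 fun i k => by
    rw [← hCv, hX0, hTT']
    exact h0 i k
  have hXk (k : ℕ) : (S.A ^ k *ᵥ X 0) ∈ S.unobservable := by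
    induction k with
    | zero => simpa using hXmem
    | succ k ih =>
      rw [pow_succ', ← Matrix.mulVec_mulVec]
      exact mulVec_mem_unobservable ih
  -- `Aᵏ X` is again an unobservable solution, so detectability applies for every `k`.
  have hKlim (k : ℕ) : Tendsto (fun t => S.K *ᵥ (S.A ^ k *ᵥ X t)) atTop (𝓝 0) :=
    h.tendsto (x := fun t => S.A ^ k *ᵥ X t) (fun t => by
      rw [Matrix.mulVec_mulVec, ← pow_succ', pow_succ, ← Matrix.mulVec_mulVec]
      exact (hX t).matrix_mulVec _) (hXk k)
  have hCzero (i : Fin l) (k : ℕ) (t : ℝ) : S.C i *ᵥ (S.A ^ k *ᵥ X t) = 0 :=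
    mem_unobservable.1 (mem_of_hasDerivAt_mulVec (fun _ => mulVec_mem_unobservable) hX hXmem t) i k
  -- The observability map of the quotient for `K` and all `Cᵢ`. It is injective by the choice of
  -- `T`, hence a closed embedding, so `x → 0` can be tested on its components.
  set Φ : (Fin q → ℝ) →ₗ[ℝ] (ℕ → (Fin r → ℝ) × ((i : Fin l) → Fin (p i) → ℝ)) :=
    LinearMap.pi fun k => ((S.K * T').mulVecLin ∘ₗ (A ^ k).mulVecLin).prod
      (LinearMap.pi fun i => (S.C i * T').mulVecLin ∘ₗ (A ^ k).mulVecLin) with hΦ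
  have hΦv (v : Fin n → ℝ) (k : ℕ) : Φ (T *ᵥ v) k =
      (S.K *ᵥ (S.A ^ k *ᵥ v), fun i => S.C i *ᵥ (S.A ^ k *ᵥ v)) := by
    rw [← hKv]
    simp only [← hCv]
    rfl
  have hΦker : LinearMap.ker Φ = ⊥ := by
    rw [LinearMap.ker_eq_bot']
    intro v hv
    rw [← hTT' v] at hv ⊢
    have hk (k : ℕ) := (hΦv (T' *ᵥ v) k).symm.trans (congrFun hv k)
    exact (hker' _).2 ⟨fun i k => congrFun (congrArg Prod.snd (hk k)) i,
      fun k => congrArg Prod.fst (hk k)⟩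
  have hemb := LinearMap.isClosedEmbedding_of_injective hΦker
  rw [hemb.tendsto_nhds_iff, map_zero, tendsto_pi_nhds]
  intro k
  have hfun : (fun t => (Φ ∘ x) t k) = fun t => (S.K *ᵥ (S.A ^ k *ᵥ X t), 0) := by
    funext t
    rw [Function.comp_apply, hxX, hΦv]
    exact Prod.ext rfl (funext fun i => hCzero i k t)
  rw [hfun]
  exact (hKlim k).prodMk_nhds tendsto_const_nhds

end DistributedSystem

/-! ### The estimator and the equivalence. -/

/-- A network whose estimation errors `wᵢ - T x` are asymptotically stable. -/
theorem DistributedSystem.JointlyPartiallyDetectable.exists_achievesOmniscience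
    {n m r l : ℕ} {p : Fin l → ℕ} {S : DistributedSystem n m r l p} (hl : 0 < l)
    {G : Digraph (Fin l)} (hbal : CommGraph.Balanced G) (hcon : CommGraph.Connected G)
    (hS : S.JointlyPartiallyDetectable) :
    ∃ (q : ℕ) (O : DistributedEstimator q m r l p), O.AchievesOmniscience G S := by
  obtain ⟨q, T, A, C, K, hA, hC, hK, hdet⟩ := hS.exists_quotient
  obtain ⟨L, M, γ, hγ, hstab⟩ := exists_asymptoticallyStable_errorMap hl hbal hcon A C hdet
  -- Local observers of `T x`: `Hᵢ` removes `u` from the error equation, and `T x` cancels in the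
  -- differences `wⱼ - wᵢ`.
  refine ⟨q, ⟨fun i => A - L i * C i, fun i => T * S.B - L i * S.D i, L, M, fun _ => K, γ, hγ⟩,
    fun x u y z w zhat hx hw i => ?_⟩
  have hode : IsODESolution (fun t i => w i t - T *ᵥ x t)
      (fun t => errorMap G A C L M γ fun i => w i t - T *ᵥ x t) := by
    refine (IsODESolution.pi fun i => (hw.state i).sub (hx.state.mulVec T)).congr_ae ?_
    filter_upwards [ae_all_iff.2 hx.output] with t ht
    funext i
    have hTA : T *ᵥ (S.A *ᵥ x t) = A *ᵥ (T *ᵥ x t) := by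
      rw [Matrix.mulVec_mulVec, Matrix.mulVec_mulVec, hA]
    have hTC : S.C i *ᵥ x t = C i *ᵥ (T *ᵥ x t) := by
      rw [Matrix.mulVec_mulVec, hC]
    change _ = A *ᵥ (w i t - T *ᵥ x t) - L i *ᵥ (C i *ᵥ (w i t - T *ᵥ x t))
      + γ • (M i *ᵥ ∑ j, CommGraph.adjacency G i j • (w j t - T *ᵥ x t - (w i t - T *ᵥ x t)))
    simp only [ht i, sub_sub_sub_cancel_right, Matrix.sub_mulVec, Matrix.mulVec_add,
      Matrix.mulVec_sub, hTA, hTC, ← Matrix.mulVec_mulVec]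
    abel
  -- The error equation is autonomous, so its right side is continuous in `t` and the solution is
  -- classical, as `AsymptoticallyStable` demands.
  have hlim := hstab _ fun t => hode.hasDerivAt
    ((LinearMap.continuous_of_finiteDimensional _).comp hode.continuous) t
  have hKlim : Tendsto (fun t => K *ᵥ (w i t - T *ᵥ x t)) atTop (𝓝 0) := by
    have hKc : Continuous fun v : Fin q → ℝ => K *ᵥ v :=
      Continuous.matrix_mulVec continuous_const continuous_id
    simpa [Function.comp_def] using (hKc.tendsto 0).comp (tendsto_pi_nhds.1 hlim i)
  refine (essTendstoZero_of_tendsto hKlim).congr_ae ?_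
  filter_upwards [hw.estimate i, hx.functional] with t ht₁ ht₂
  rw [ht₁, ht₂, Matrix.mulVec_sub, Matrix.mulVec_mulVec, hK]

theorem mainTheorem1 (n m r l : ℕ) (hl : 0 < l) (p : Fin l → ℕ)
    (S : DistributedSystem n m r l p) (G : Digraph (Fin l))
    (hG : (CommGraph.Balanced G ∧ CommGraph.StronglyConnected G) ∨
      (CommGraph.Undirected G ∧ CommGraph.Connected G)) :
    (∃ (q : ℕ) (O : DistributedEstimator q m r l p), O.AchievesOmniscience G S) ↔
      S.JointlyPartiallyDetectable := by
  refine ⟨fun ⟨_, _, hO⟩ => hO.jointlyPartiallyDetectable hl, fun hS => ?_⟩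
  rcases hG with ⟨hbal, hcon⟩ | ⟨hund, hcon⟩
  · exact hS.exists_achievesOmniscience hl hbal hcon.connected
  · exact hS.exists_achievesOmniscience hl hund.balanced hcon
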